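/- Let $T>0$, $\lambda>0$, $\Theta\subset\mathbb{R}^p$, let $C\in\mathbb{R}^{d'\times d}$ be a matrix, and for each $\theta$ let $A_\theta:[0,T]\to\mathbb{R}^{d\times d}$ and $r_\theta:[0,T]\to\mathbb{R}^d$. For $x_0\in\mathbb{R}^d$ and $u\in L^2([0,T],\mathbb{R}^d)$ let $X_{\theta,x_0,u}$ be the (absolutely continuous) solution on $[0,T]$ of $\dot x=A_\theta x+r_\theta+u$, $x(0)=x_0$, and put $X_{\theta,x_0}=X_{\theta,x_0,0}$. Let $\Phi_\theta(\cdot,0)$ be the matrix solution of $\dot\Phi=A_\theta\Phi$, $\Phi(0)=I_d$, and let $O_\theta(T)=\int_0^T\Phi_\theta(t,0)^\top C^\top C\,\Phi_\theta(t,0)\,dt$ be the observability Gramian. For a $d\times d$ matrix $Q$ and $\zeta\in L^2([0,T],\mathbb{R}^{d'})$ define the profiled cost $$S(\zeta;\theta,\lambda)=\inf_{x_0\in\mathbb{R}^d}\ \inf_{u\in L^2}\left\{x_0^\top Qx_0+\int_0^T\|\zeta(t)-CX_{\theta,x_0,u}(t)\|_2^2\,dt+\lambda\int_0^T\|u(t)\|_2^2\,dt\right\}.$$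 Let $\theta^*\in\Theta$, $x_0^*\in\mathbb{R}^d$ and $Y^*=CX_{\theta^*,x_0^*}$. Assume: * (C1) $\Theta$ is compact and $\theta^*$ lies in the interior of $\Theta$; * (C2a) $Q=0$ and $O_\theta(T)$ is nonsingular for every $\theta\in\Theta$; * (C2b) for all $(\theta,x_0)\in\Theta\times\mathbb{R}^d$, if $CX_{\theta,x_0}=CX_{\theta^*,x_0^*}$ on $[0,T]$, then $(\theta,x_0)=(\theta^*,x_0^*)$; * (C3) $(t,\theta)\mapsto A_\theta(t)$ and $(t,\theta)\mapsto r_\theta(t)$ are continuous on $[0,T]\times\Theta$. Let $(\widehat Y_n)_{n}$ be a sequence of random functions, defined on a common probability space and almost surely in $L^2([0,T],\mathbb{R}^{d'})$, that is consistent in probability in $L^2$, i.e. $\mathbb{P}(\|\widehat Y_n-Y^*\|_{L^2}\ge\varepsilon)\to0$ for every $\varepsilon>0$. For each $n$ let $\widehat\theta^K_n\in\Theta$ be, almost surely, a minimizer over $\Theta$ of $\theta\mapsto S(\widehat Y_n;\theta,\lambda)$. Then $\widehat\theta^K_n\to\theta^*$ in probability as $n\to\infty$. -/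

import Mathlib

open MeasureTheory Set Filter Topology

noncomputable section

namespace KalmanODE

/-- Data of a parametric linear ODE `ẋ(t) = A_θ(t) x(t) + r_θ(t)` on `[0, T]`, with parameter
`θ ∈ ℝ^p`, state in `ℝ^d`, and output `C x(t) ∈ ℝ^q`. -/
structure LinearModel (p d q : ℕ) where
  /-- time horizon -/
  T : ℝ
  /-- the drift matrix `A_θ(t)` -/
  A : EuclideanSpace ℝ (Fin p) → ℝ → Matrix (Fin d) (Fin d) ℝ
  /-- the inhomogeneous term `r_θ(t)` -/
  r : EuclideanSpace ℝ (Fin p) → ℝ → EuclideanSpace ℝ (Fin d)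
  /-- the observation matrix -/
  C : Matrix (Fin q) (Fin d) ℝ

namespace LinearModel

variable {p d q : ℕ}

/-- Lebesgue measure on `[0, T]`. -/
abbrev leb (M : LinearModel p d q) : Measure ℝ := volume.restrict (Icc 0 M.T)

/-- The output `C x` of a state `x`. -/
def output (M : LinearModel p d q) (x : EuclideanSpace ℝ (Fin d)) : EuclideanSpace ℝ (Fin q) :=
  WithLp.toLp 2 (M.C.mulVec x.ofLp)

/-- The right-hand side `A_θ(t) x + r_θ(t)` of the ODE. -/
def field (M : LinearModel p d q) (θ : EuclideanSpace ℝ (Fin p)) (t : ℝ)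
    (x : EuclideanSpace ℝ (Fin d)) : EuclideanSpace ℝ (Fin d) :=
  WithLp.toLp 2 ((M.A θ t).mulVec x.ofLp) + M.r θ t

/-- `x` is the (Carathéodory, i.e. absolutely continuous) solution on `[0, T]` of
`ẋ = A_θ x + r_θ + u`, `x(0) = x₀`, written in integral form. -/
def IsSolution (M : LinearModel p d q) (θ : EuclideanSpace ℝ (Fin p))
    (x₀ : EuclideanSpace ℝ (Fin d)) (u x : ℝ → EuclideanSpace ℝ (Fin d)) : Prop :=
  ContinuousOn x (Icc 0 M.T) ∧
    ∀ t ∈ Icc 0 M.T, x t = x₀ + ∫ s in (0 : ℝ)..t, (M.field θ s (x s) + u s)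

open Classical in
/-- The trajectory `X_{θ, x₀, u}`: the solution on `[0, T]` of `ẋ = A_θ x + r_θ + u`, `x(0) = x₀`.
For continuous `A_θ`, `r_θ` and `u ∈ L²` it exists and is unique on `[0, T]`. -/
def trajectory (M : LinearModel p d q) (θ : EuclideanSpace ℝ (Fin p))
    (x₀ : EuclideanSpace ℝ (Fin d)) (u : ℝ → EuclideanSpace ℝ (Fin d)) :
    ℝ → EuclideanSpace ℝ (Fin d) :=
  if h : ∃ x, M.IsSolution θ x₀ u x then h.choose else 0

/-- `Φ` is the resolvent `t ↦ Φ_θ(t, s)` of the homogeneous ODE started at time `s`: the matrix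
solution on `[0, T]` of `Φ̇ = A_θ Φ` with `Φ(s) = I`. -/
def IsResolvent (M : LinearModel p d q) (θ : EuclideanSpace ℝ (Fin p)) (s : ℝ)
    (Φ : ℝ → Matrix (Fin d) (Fin d) ℝ) : Prop :=
  Φ s = 1 ∧ ∀ t ∈ Icc 0 M.T, ∀ i j,
    HasDerivWithinAt (fun τ => Φ τ i j) ((M.A θ t * Φ t) i j) (Icc 0 M.T) t

open Classical in
/-- The resolvent `Φ_θ(t, s)`, which exists and is unique on `[0, T]` for continuous `A_θ`. -/
def resolvent (M : LinearModel p d q) (θ : EuclideanSpace ℝ (Fin p)) (t s : ℝ) :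
    Matrix (Fin d) (Fin d) ℝ :=
  if h : ∃ Φ, M.IsResolvent θ s Φ then h.choose t else 0

/-- The observability Gramian `O_θ(T) = ∫₀ᵀ Φ_θ(t, 0)ᵀ Cᵀ C Φ_θ(t, 0) dt` (entrywise integral). -/
def gramian (M : LinearModel p d q) (θ : EuclideanSpace ℝ (Fin p)) :
    Matrix (Fin d) (Fin d) ℝ :=
  Matrix.of fun i j => ∫ t in (0 : ℝ)..M.T,
    ((M.resolvent θ t 0).transpose * M.C.transpose * M.C * M.resolvent θ t 0) i j

/-- The cost `x₀ᵀ Q x₀ + ∫₀ᵀ ‖ζ(t) - C X_{θ, x₀, u}(t)‖² dt + lam ∫₀ᵀ ‖u(t)‖² dt`. -/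
def cost (M : LinearModel p d q) (Q : Matrix (Fin d) (Fin d) ℝ)
    (ζ : ℝ → EuclideanSpace ℝ (Fin q)) (x₀ : EuclideanSpace ℝ (Fin d))
    (u : ℝ → EuclideanSpace ℝ (Fin d)) (θ : EuclideanSpace ℝ (Fin p)) (lam : ℝ) : ℝ :=
  x₀.ofLp ⬝ᵥ Q.mulVec x₀.ofLp
    + (∫ t, ‖ζ t - M.output (M.trajectory θ x₀ u t)‖ ^ 2 ∂M.leb)
    + lam * ∫ t, ‖u t‖ ^ 2 ∂M.leb

/-- The profiled cost `S(ζ; θ, lam) = inf_{x₀ ∈ ℝ^d} inf_{u ∈ L²} cost`. -/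
def profiledCost (M : LinearModel p d q) (Q : Matrix (Fin d) (Fin d) ℝ)
    (ζ : ℝ → EuclideanSpace ℝ (Fin q)) (θ : EuclideanSpace ℝ (Fin p)) (lam : ℝ) : ℝ :=
  ⨅ x₀ : EuclideanSpace ℝ (Fin d), ⨅ u : Lp (EuclideanSpace ℝ (Fin d)) 2 M.leb,
    M.cost Q ζ x₀ u θ lam

/-- The uncontrolled output `t ↦ C X_{θ, x₀}(t)`. -/
def freeOutput (M : LinearModel p d q) (θ : EuclideanSpace ℝ (Fin p))
    (x₀ : EuclideanSpace ℝ (Fin d)) (t : ℝ) : EuclideanSpace ℝ (Fin q) :=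
  M.output (M.trajectory θ x₀ 0 t)

/-- Joint identifiability at `(θs, x₀s)`: over `Θ × ℝ^d`, only `(θs, x₀s)` yields its output. -/
def Identifiable (M : LinearModel p d q) (Θ : Set (EuclideanSpace ℝ (Fin p)))
    (θs : EuclideanSpace ℝ (Fin p)) (x₀s : EuclideanSpace ℝ (Fin d)) : Prop :=
  ∀ θ ∈ Θ, ∀ x₀ : EuclideanSpace ℝ (Fin d),
    EqOn (M.freeOutput θ x₀) (M.freeOutput θs x₀s) (Icc 0 M.T) → θ = θs ∧ x₀ = x₀s

/-- `θ` is a minimizer over `Θ` of the profiled cost `S(ζ; ·, lam)`. -/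
def IsEstimate (M : LinearModel p d q) (Q : Matrix (Fin d) (Fin d) ℝ)
    (Θ : Set (EuclideanSpace ℝ (Fin p))) (ζ : ℝ → EuclideanSpace ℝ (Fin q)) (lam : ℝ)
    (θ : EuclideanSpace ℝ (Fin p)) : Prop :=
  θ ∈ Θ ∧ ∀ θ' ∈ Θ, M.profiledCost Q ζ θ lam ≤ M.profiledCost Q ζ θ' lam

end LinearModel

end KalmanODE

end

/-!
The argument is deterministic: when `ζ` is `L²`-close to the true output `Y*`, every minimizer over
`Θ` of the profiled cost of `ζ` is close to `θ*` (`exists_forall_isEstimate_dist_lt`). Consistency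
in probability follows, since the event that the estimator is far from `θ*` is then almost surely
contained in the event that `Ŷₙ` is far from `Y*`.

For the deterministic claim, suppose `ζₙ → Y*` in `L²` while minimizers `θₙ` stay away from `θ*`.
The minimal cost at `θₙ` is at most the cost of the true initial value without control at `θ*`,
that is `‖ζₙ - Y*‖²`, so there are initial values `xₙ` and controls `uₙ` of vanishing cost: `uₙ → 0`
and `C X_{θₙ, xₙ, uₙ} → Y*` in `L²`, the weight `lam` being positive. Pass to a subsequence with
`θₙ → θ₀ ∈ Θ`. Solutions of linear equations depend continuously on the coefficients, the forcing
and the initial value (`IsLinearSolution.tendstoUniformlyOn`, a consequence of Grönwall's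
inequality), and the forcing only has to converge in mean, so the controls drop out in the limit
(`output_eqOn_of_tendsto`).

This is used twice. If `‖xₙ‖ → ∞`, rescaling by `‖xₙ‖⁻¹` makes the data and the inhomogeneity vanish
and produces a unit vector `v` with `C Φ_{θ₀}(·, 0) v = 0`, against the nonsingularity of the
Gramian (`exists_frequently_norm_le`). So along a further subsequence `xₙ → x₀`, and then
`C X_{θ₀, x₀} = Y*`, whence `θ₀ = θ*` by identifiability (`exists_subseq_tendsto`).

Since trajectories and resolvents are defined by choice, their existence on all of `[0, T]` is
needed; it comes from a fixed point argument in an exponentially weighted norm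
(`exists_isLinearSolution`).
-/

/-! ### Linear integral equations in a Banach space -/

section LinearODE

variable {E : Type*} [NormedAddCommGroup E]

theorem ContinuousOn.intervalIntegrable_of_mem_Icc {f : ℝ → E} {T t : ℝ}
    (hf : ContinuousOn f (Icc 0 T)) (ht : t ∈ Icc 0 T) : IntervalIntegrable f volume 0 t :=
  (hf.mono (by rw [uIcc_of_le ht.1]; exact Icc_subset_Icc_right ht.2)).intervalIntegrable

theorem IntervalIntegrable.mono_right_Icc {f : ℝ → E} {T t : ℝ}
    (hf : IntervalIntegrable f volume 0 T) (ht : t ∈ Icc 0 T) : IntervalIntegrable f volume 0 t :=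
  hf.mono_set (by
    rw [uIcc_of_le ht.1, uIcc_of_le (ht.1.trans ht.2)]; exact Icc_subset_Icc_right ht.2)

variable [NormedSpace ℝ E]

/-- `x` solves `ẋ = a x + g`, `x 0 = x₀` on `[0, T]` in integral form, the coefficient `a` being
operator-valued. The integral form is meant for forcings `g` that are merely integrable; the
integrability is a hypothesis of the lemmas. -/
def IsLinearSolution (T : ℝ) (a : ℝ → E →L[ℝ] E) (g : ℝ → E) (x₀ : E) (x : ℝ → E) : Prop :=
  ContinuousOn x (Icc 0 T) ∧ ∀ t ∈ Icc 0 T, x t = x₀ + ∫ s in (0 : ℝ)..t, (a s (x s) + g s)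

/-- Grönwall's inequality in integral form. -/
theorem le_mul_exp_of_le_integral {T K c : ℝ} (hK : 0 ≤ K) (hc : 0 ≤ c) {f : ℝ → ℝ}
    (hf : ContinuousOn f (Icc 0 T)) (hf0 : ∀ t ∈ Icc 0 T, 0 ≤ f t)
    (h : ∀ t ∈ Icc 0 T, f t ≤ c + K * ∫ s in (0 : ℝ)..t, f s) :
    ∀ t ∈ Icc 0 T, f t ≤ c * Real.exp (K * t) := by
  intro t ht
  have hT : 0 ≤ T := ht.1.trans ht.2
  set F : ℝ → ℝ := IccExtend hT ((Icc 0 T).domRestrict f)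
  have hF : Continuous F := hf.domRestrict.Icc_extend'
  have hFf : ∀ s ∈ Icc 0 T, F s = f s := fun s hs => IccExtend_of_mem hT _ hs
  have hF0 : ∀ s, 0 ≤ F s := fun s => hf0 _ (projIcc 0 T hT s).2
  have hint : ∀ s ∈ Icc 0 T, ∫ τ in (0 : ℝ)..s, f τ = ∫ τ in (0 : ℝ)..s, F τ := fun s hs =>
    intervalIntegral.integral_congr fun τ hτ => by
      rw [uIcc_of_le hs.1] at hτ
      exact (hFf τ ⟨hτ.1, hτ.2.trans hs.2⟩).symm
  set H : ℝ → ℝ := fun s => c + K * ∫ τ in (0 : ℝ)..s, F τ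
  have hH : ∀ s, HasDerivAt H (K * F s) s := fun s =>
    ((hF.integral_hasStrictDerivAt 0 s).hasDerivAt.const_mul K).const_add c
  have hH0 : ∀ s ∈ Icc 0 T, 0 ≤ H s := fun s hs => add_nonneg hc
    (mul_nonneg hK (intervalIntegral.integral_nonneg hs.1 fun τ _ => hF0 τ))
  have hle : ∀ s ∈ Icc 0 T, F s ≤ H s := fun s hs => by
    rw [hFf s hs]; simpa only [H, hint s hs] using h s hs
  have key := norm_le_gronwallBound_of_norm_deriv_right_le (f := H) (f' := fun s => K * F s)
    (δ := c) (K := K) (ε := 0) (a := 0) (b := T)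
    (fun s _ => (hH s).continuousAt.continuousWithinAt) (fun s _ => (hH s).hasDerivWithinAt)
    (by simp [H, abs_of_nonneg hc])
    (fun s hs => by
      have hs' := Ico_subset_Icc_self hs
      rw [Real.norm_of_nonneg (mul_nonneg hK (hF0 s)), Real.norm_of_nonneg (hH0 s hs'), add_zero]
      exact mul_le_mul_of_nonneg_left (hle s hs') hK) t ht
  rw [gronwallBound_ε0, sub_zero, Real.norm_of_nonneg (hH0 t ht)] at key
  exact (hFf t ht).symm.le.trans ((hle t ht).trans key)

namespace IsLinearSolution

variable {T : ℝ} {a b : ℝ → E →L[ℝ] E} {g h : ℝ → E} {x₀ y₀ : E} {x y : ℝ → E}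

theorem apply_zero (hT : 0 ≤ T) (hx : IsLinearSolution T a g x₀ x) : x 0 = x₀ := by
  simpa using hx.2 0 ⟨le_rfl, hT⟩

/-- Only the values of the forcing almost everywhere on `[0, T]` matter. -/
theorem congr_forcing (hx : IsLinearSolution T a g x₀ x)
    (hgh : g =ᵐ[volume.restrict (Icc 0 T)] h) : IsLinearSolution T a h x₀ x := by
  refine ⟨hx.1, fun t ht => ?_⟩
  rw [hx.2 t ht]
  congr 1
  refine intervalIntegral.integral_congr_ae ?_
  rw [uIoc_of_le ht.1]
  have := (ae_restrict_iff' measurableSet_Icc).1 hgh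
  filter_upwards [this] with s hs hst
  rw [hs ⟨hst.1.le, hst.2.trans ht.2⟩]

theorem smul (c : ℝ) (hx : IsLinearSolution T a g x₀ x) :
    IsLinearSolution T a (fun t => c • g t) (c • x₀) (fun t => c • x t) := by
  refine ⟨hx.1.const_smul c, fun t ht => ?_⟩
  simp only [map_smul, ← smul_add, intervalIntegral.integral_smul]
  rw [hx.2 t ht]

/-- The difference of two solutions solves the first equation, the discrepancy of the coefficients
being moved into the forcing. -/
theorem sub (ha : ContinuousOn a (Icc 0 T)) (hb : ContinuousOn b (Icc 0 T))
    (hg : IntervalIntegrable g volume 0 T) (hh : IntervalIntegrable h volume 0 T)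
    (hx : IsLinearSolution T a g x₀ x) (hy : IsLinearSolution T b h y₀ y) :
    IsLinearSolution T a (fun t => (a t - b t) (y t) + (g t - h t)) (x₀ - y₀)
      (fun t => x t - y t) := by
  refine ⟨hx.1.sub hy.1, fun t ht => ?_⟩
  have h1 : IntervalIntegrable (fun s => a s (x s) + g s) volume 0 t :=
    ((ha.clm_apply hx.1).intervalIntegrable_of_mem_Icc ht).add (hg.mono_right_Icc ht)
  have h2 : IntervalIntegrable (fun s => b s (y s) + h s) volume 0 t :=
    ((hb.clm_apply hy.1).intervalIntegrable_of_mem_Icc ht).add (hh.mono_right_Icc ht)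
  simp only
  rw [hx.2 t ht, hy.2 t ht, add_sub_add_comm, ← intervalIntegral.integral_sub h1 h2]
  congr 2
  ext s
  simp only [map_sub, _root_.sub_apply]
  abel

/-- The a priori bound for linear equations. -/
theorem norm_le {K : ℝ} (hK : 0 ≤ K) (ha : ContinuousOn a (Icc 0 T))
    (haK : ∀ t ∈ Icc 0 T, ‖a t‖ ≤ K) (hg : IntervalIntegrable g volume 0 T)
    (hx : IsLinearSolution T a g x₀ x) :
    ∀ t ∈ Icc 0 T, ‖x t‖ ≤ (‖x₀‖ + ∫ s in (0 : ℝ)..T, ‖g s‖) * Real.exp (K * T) := by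
  intro t ht
  have hT : 0 ≤ T := ht.1.trans ht.2
  have hc : 0 ≤ ‖x₀‖ + ∫ s in (0 : ℝ)..T, ‖g s‖ :=
    add_nonneg (norm_nonneg _) (intervalIntegral.integral_nonneg hT fun _ _ => norm_nonneg _)
  refine (le_mul_exp_of_le_integral hK hc hx.1.norm (fun _ _ => norm_nonneg _) ?_ t ht).trans
    (mul_le_mul_of_nonneg_left (Real.exp_le_exp.2 (mul_le_mul_of_nonneg_left ht.2 hK)) hc)
  intro t ht
  have hax := (ha.clm_apply hx.1).intervalIntegrable_of_mem_Icc ht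
  have hgt := hg.mono_right_Icc ht
  have hxt := hx.1.norm.intervalIntegrable_of_mem_Icc ht
  rw [hx.2 t ht, intervalIntegral.integral_add hax hgt]
  have h1 : ‖∫ s in (0 : ℝ)..t, a s (x s)‖ ≤ K * ∫ s in (0 : ℝ)..t, ‖x s‖ := by
    rw [← intervalIntegral.integral_const_mul]
    refine (intervalIntegral.norm_integral_le_integral_norm ht.1).trans
      (intervalIntegral.integral_mono_on ht.1 hax.norm (hxt.const_mul K) fun s hs => ?_)
    exact (a s).le_of_opNorm_le (haK s ⟨hs.1, hs.2.trans ht.2⟩) _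
  have h2 : ‖∫ s in (0 : ℝ)..t, g s‖ ≤ ∫ s in (0 : ℝ)..T, ‖g s‖ := by
    refine (intervalIntegral.norm_integral_le_integral_norm ht.1).trans ?_
    exact intervalIntegral.integral_mono_interval le_rfl ht.1 ht.2
      (ae_of_all _ fun _ => norm_nonneg _) hg.norm
  have h3 := norm_add₃_le (a := x₀) (b := ∫ s in (0 : ℝ)..t, a s (x s))
    (c := ∫ s in (0 : ℝ)..t, g s)
  rw [← add_assoc]
  linarith

/-- Continuous dependence of the solution on the coefficient (uniformly), on the forcing (in mean)
and on the initial value. -/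
theorem tendstoUniformlyOn {ι : Type*} {l : Filter ι} (hT : 0 ≤ T)
    {an : ι → ℝ → E →L[ℝ] E} {gn : ι → ℝ → E} {xn₀ : ι → E} {xn : ι → ℝ → E}
    (ha : ContinuousOn a (Icc 0 T)) (han : ∀ n, ContinuousOn (an n) (Icc 0 T))
    (hg : IntervalIntegrable g volume 0 T) (hgn : ∀ n, IntervalIntegrable (gn n) volume 0 T)
    (hx : IsLinearSolution T a g x₀ x) (hxn : ∀ n, IsLinearSolution T (an n) (gn n) (xn₀ n) (xn n))
    (ha_lim : TendstoUniformlyOn an a l (Icc 0 T))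
    (hg_lim : Tendsto (fun n => ∫ t in (0 : ℝ)..T, ‖gn n t - g t‖) l (𝓝 0))
    (h0_lim : Tendsto xn₀ l (𝓝 x₀)) :
    TendstoUniformlyOn xn x l (Icc 0 T) := by
  obtain ⟨K, hK⟩ := isCompact_Icc.exists_bound_of_continuousOn ha
  obtain ⟨R, hR⟩ := isCompact_Icc.exists_bound_of_continuousOn hx.1
  have h0T : (0 : ℝ) ∈ Icc 0 T := ⟨le_rfl, hT⟩
  have hK0 : 0 ≤ K := (norm_nonneg _).trans (hK 0 h0T)
  have hR0 : 0 ≤ R := (norm_nonneg _).trans (hR 0 h0T)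
  rw [Metric.tendstoUniformlyOn_iff] at ha_lim ⊢
  intro ε hε
  -- `an n` is eventually bounded by `K + 1`, so `B` is the constant of the a priori bound for the
  -- difference; its initial value, coefficient and forcing errors are each made at most `δ`
  set B := Real.exp ((K + 1) * T)
  have hB : 0 < B := Real.exp_pos _
  set δ := ε / (4 * B)
  have hδ : 0 < δ := by positivity
  set η := min 1 (δ / (T * R + 1))
  have hη : 0 < η := lt_min one_pos (by positivity)
  have hηδ : T * (η * R) ≤ δ := by
    have : η * (T * R + 1) ≤ δ := (le_div_iff₀ (by positivity)).1 (min_le_right _ _)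
    nlinarith
  filter_upwards [ha_lim η hη, hg_lim.eventually (gt_mem_nhds hδ),
    (tendsto_iff_norm_sub_tendsto_zero.1 h0_lim).eventually (gt_mem_nhds hδ)] with n h1 h2 h3 t ht
  have hdiff : ∀ t ∈ Icc 0 T, ‖an n t - a t‖ ≤ η := fun t ht => by
    have := h1 t ht
    rw [dist_comm, dist_eq_norm] at this
    exact this.le
  have hbd : ∀ t ∈ Icc 0 T, ‖an n t‖ ≤ K + 1 := fun t ht => by
    have e1 := norm_le_norm_add_norm_sub' (an n t) (a t)
    have e2 := hdiff t ht
    have e3 := hK t ht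
    have e4 : η ≤ 1 := min_le_left _ _
    linarith
  have hi1 : IntervalIntegrable (fun t => (an n t - a t) (x t)) volume 0 T :=
    (((han n).sub ha).clm_apply hx.1).intervalIntegrable_of_mem_Icc ⟨hT, le_rfl⟩
  have hi2 : IntervalIntegrable (fun t => gn n t - g t) volume 0 T := (hgn n).sub hg
  have key := ((hxn n).sub (han n) ha (hgn n) hg hx).norm_le (by linarith) (han n) hbd
    (hi1.add hi2) t ht
  have hint : ∫ s in (0 : ℝ)..T, ‖(an n s - a s) (x s) + (gn n s - g s)‖ ≤ δ + δ := by
    have : ∫ s in (0 : ℝ)..T, ‖(an n s - a s) (x s) + (gn n s - g s)‖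
        ≤ ∫ s in (0 : ℝ)..T, (η * R + ‖gn n s - g s‖) := by
      refine intervalIntegral.integral_mono_on hT (hi1.add hi2).norm
        (intervalIntegrable_const.add hi2.norm) fun s hs => (norm_add_le _ _).trans ?_
      gcongr
      exact (an n s - a s).le_of_opNorm_le_of_le (hdiff s hs) (hR s hs)
    refine this.trans ?_
    rw [intervalIntegral.integral_add intervalIntegrable_const hi2.norm,
      intervalIntegral.integral_const, sub_zero, smul_eq_mul]
    exact add_le_add hηδ h2.le
  rw [dist_comm, dist_eq_norm]
  calc ‖xn n t - x t‖ ≤ _ := key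
    _ ≤ (δ + (δ + δ)) * B := by gcongr
    _ < ε := by
      have : δ * B = ε / 4 := by simp only [δ]; field_simp
      linarith

end IsLinearSolution

/-- Global existence for linear equations. In the unknown `w t = exp (-L t) • x t` the integral
operator is a contraction of `C([0, T], E)` once `L` exceeds the bound on the coefficient. -/
theorem exists_isLinearSolution [CompleteSpace E] {T : ℝ} (hT : 0 ≤ T) {a : ℝ → E →L[ℝ] E}
    {g : ℝ → E} (ha : ContinuousOn a (Icc 0 T)) (hg : IntervalIntegrable g volume 0 T) (x₀ : E) :
    ∃ x, IsLinearSolution T a g x₀ x := by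
  obtain ⟨K, hK⟩ := isCompact_Icc.exists_bound_of_continuousOn ha
  have hK0 : 0 ≤ K := (norm_nonneg _).trans (hK 0 ⟨le_rfl, hT⟩)
  set L : ℝ := 2 * K + 1
  have hL : 0 < L := by positivity
  set α : ℝ → E →L[ℝ] E := IccExtend hT ((Icc 0 T).domRestrict a)
  have hα : Continuous α := ha.domRestrict.Icc_extend'
  have hαa : ∀ s ∈ Icc 0 T, α s = a s := fun s hs => IccExtend_of_mem hT _ hs
  have hαK : ∀ s, ‖α s‖ ≤ K := fun s => hK _ (projIcc 0 T hT s).2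
  have hgIcc : IntegrableOn g (Icc 0 T) := by
    rwa [integrableOn_Icc_iff_integrableOn_Ioc, ← intervalIntegrable_iff_integrableOn_Ioc_of_le hT]
  have hG : ContinuousOn (fun t => ∫ s in (0 : ℝ)..t, g s) (Icc 0 T) := by
    have := intervalIntegral.continuousOn_primitive_interval
      (by rwa [uIcc_of_le hT] : IntegrableOn g (uIcc 0 T))
    rwa [uIcc_of_le hT] at this
  -- the integrand of the Picard operator, as a continuous function on the whole line
  set I : C(Icc 0 T, E) → ℝ → E := fun w s => α s (Real.exp (L * s) • IccExtend hT w s)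
  have hI : ∀ w, Continuous (I w) := fun w =>
    hα.clm_apply (Continuous.smul (by fun_prop) w.continuous.Icc_extend')
  set P : C(Icc 0 T, E) → C(Icc 0 T, E) := fun w =>
    { toFun := fun t => Real.exp (-(L * t)) •
        (x₀ + (∫ s in (0 : ℝ)..t, g s) + ∫ s in (0 : ℝ)..t, I w s)
      continuous_toFun := by
        have h1 : Continuous fun t : Icc (0 : ℝ) T => ∫ s in (0 : ℝ)..t, g s := hG.domRestrict
        have h2 : Continuous fun t : Icc (0 : ℝ) T => ∫ s in (0 : ℝ)..t, I w s :=
          (intervalIntegral.continuous_primitive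
            (fun _ _ => (hI w).intervalIntegrable _ _) 0).comp continuous_subtype_val
        exact Continuous.smul (by fun_prop) ((continuous_const.add h1).add h2) }
  have hP : ContractingWith (1 / 2) P := by
    refine ⟨by rw [← NNReal.coe_lt_coe]; norm_num, LipschitzWith.of_dist_le_mul fun v w => ?_⟩
    refine (ContinuousMap.dist_le (by positivity)).2 fun t => ?_
    have ht : (0 : ℝ) ≤ t := t.2.1
    have hexp : ∫ s in (0 : ℝ)..t, Real.exp (L * s) = (Real.exp (L * t) - 1) / L := by
      rw [intervalIntegral.integral_comp_mul_left (fun s => Real.exp s) hL.ne']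
      simp [div_eq_inv_mul]
    have hi : ‖∫ s in (0 : ℝ)..t, (I v s - I w s)‖ ≤
        ∫ s in (0 : ℝ)..t, K * dist v w * Real.exp (L * s) := by
      refine intervalIntegral.norm_integral_le_of_norm_le ht (ae_of_all _ fun s _ => ?_)
        (Continuous.intervalIntegrable (by fun_prop) _ _)
      simp only [I, ← map_sub, ← smul_sub]
      refine ((α s).le_of_opNorm_le (hαK s) _).trans ?_
      rw [norm_smul, Real.norm_of_nonneg (Real.exp_pos _).le, ← dist_eq_norm, mul_assoc,
        mul_comm (dist v w)]
      gcongr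
      exact ContinuousMap.dist_apply_le_dist _
    have hPt : P v t - P w t = Real.exp (-(L * t)) • ∫ s in (0 : ℝ)..t, (I v s - I w s) := by
      rw [intervalIntegral.integral_sub ((hI v).intervalIntegrable _ _)
        ((hI w).intervalIntegrable _ _)]
      simp only [P, ContinuousMap.coe_mk, ← smul_sub, add_sub_add_left_eq_sub]
    rw [dist_eq_norm, hPt, norm_smul, Real.norm_of_nonneg (Real.exp_pos _).le]
    calc Real.exp (-(L * t)) * ‖∫ s in (0 : ℝ)..t, (I v s - I w s)‖
        ≤ Real.exp (-(L * t)) * (K * dist v w * ((Real.exp (L * t) - 1) / L)) := by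
          rw [intervalIntegral.integral_const_mul, hexp] at hi
          gcongr
      _ = K / L * dist v w * (1 - Real.exp (-(L * t))) := by
          rw [Real.exp_neg]
          field_simp
      _ ≤ 1 / 2 * dist v w * 1 := by
          have : K / L ≤ 1 / 2 := by rw [div_le_iff₀ hL]; simp only [L]; linarith
          gcongr
          · linarith [Real.exp_le_one_iff.2 (neg_nonpos.2 (mul_nonneg hL.le ht))]
          · linarith [Real.exp_pos (-(L * t))]
      _ = ↑(1 / 2 : NNReal) * dist v w := by push_cast; ring
  have : Nonempty (Icc (0 : ℝ) T) := ⟨⟨0, le_rfl, hT⟩⟩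
  set w := ContractingWith.fixedPoint P hP
  have hw : ∀ t : Icc (0 : ℝ) T, w t = Real.exp (-(L * t)) •
      (x₀ + (∫ s in (0 : ℝ)..t, g s) + ∫ s in (0 : ℝ)..t, I w s) := fun t =>
    (DFunLike.congr_fun hP.fixedPoint_isFixedPt t).symm
  refine ⟨fun t => Real.exp (L * t) • IccExtend hT w t, Continuous.continuousOn
    (Continuous.smul (by fun_prop) w.continuous.Icc_extend'), fun t ht => ?_⟩
  have hcongr : ∫ s in (0 : ℝ)..t, I w s =
      ∫ s in (0 : ℝ)..t, a s (Real.exp (L * s) • IccExtend hT w s) :=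
    intervalIntegral.integral_congr fun s hs => by
      rw [uIcc_of_le ht.1] at hs
      simp only [I, hαa s ⟨hs.1, hs.2.trans ht.2⟩]
  have hIw : IntervalIntegrable (fun s => a s (Real.exp (L * s) • IccExtend hT w s)) volume 0 t :=
    (ha.clm_apply (Continuous.smul (by fun_prop)
      w.continuous.Icc_extend').continuousOn).intervalIntegrable_of_mem_Icc ht
  rw [intervalIntegral.integral_add hIw (hg.mono_right_Icc ht), ← hcongr]
  simp only
  rw [IccExtend_of_mem hT _ ht, hw, smul_smul, ← Real.exp_add, add_neg_cancel, Real.exp_zero,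
    one_smul]
  abel

end LinearODE

/-! ### Convergence on a compact interval -/

theorem integral_Icc_eq_intervalIntegral {T : ℝ} (hT : 0 ≤ T) (f : ℝ → ℝ) :
    ∫ t in Icc 0 T, f t = ∫ t in (0 : ℝ)..T, f t := by
  rw [intervalIntegral.integral_of_le hT, integral_Icc_eq_integral_Ioc]

theorem MeasureTheory.MemLp.intervalIntegrable_of_Icc {E : Type*} [NormedAddCommGroup E] {T : ℝ}
    (hT : 0 ≤ T) {u : ℝ → E} (hu : MemLp u 2 (volume.restrict (Icc 0 T))) :
    IntervalIntegrable u volume 0 T := by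
  rw [intervalIntegrable_iff_integrableOn_Ioc_of_le hT, ← integrableOn_Icc_iff_integrableOn_Ioc]
  exact hu.integrable one_le_two

theorem ContinuousOn.memLp_restrict_Icc {E : Type*} [NormedAddCommGroup E] {T : ℝ} {f : ℝ → E}
    (hf : ContinuousOn f (Icc 0 T)) : MemLp f 2 (volume.restrict (Icc 0 T)) := by
  obtain ⟨B, hB⟩ := isCompact_Icc.exists_bound_of_continuousOn hf
  exact MemLp.of_bound (hf.aestronglyMeasurable measurableSet_Icc) B
    ((ae_restrict_iff' measurableSet_Icc).2 (ae_of_all _ hB))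

/-- A jointly continuous function restricts to uniformly convergent slices. -/
theorem tendstoUniformlyOn_slice {X F : Type*} [PseudoMetricSpace X] [PseudoMetricSpace F]
    {S : Set ℝ} {Θ : Set X} {f : X → ℝ → F} (hS : IsCompact S) (hΘ : IsCompact Θ)
    (hf : ContinuousOn (fun z : ℝ × X => f z.2 z.1) (S ×ˢ Θ)) {ι : Type*} {l : Filter ι}
    {θ : ι → X} (hθ : ∀ n, θ n ∈ Θ) {θ₀ : X} (hθ₀ : θ₀ ∈ Θ) (hlim : Tendsto θ l (𝓝 θ₀)) :
    TendstoUniformlyOn (fun n => f (θ n)) (f θ₀) l S := by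
  have huc := Metric.uniformContinuousOn_iff.1 ((hS.prod hΘ).uniformContinuousOn_of_continuous hf)
  rw [Metric.tendstoUniformlyOn_iff]
  intro ε hε
  obtain ⟨δ, hδ, h⟩ := huc ε hε
  filter_upwards [hlim.eventually (Metric.ball_mem_nhds θ₀ hδ)] with n hn t ht
  refine h (t, θ₀) ⟨ht, hθ₀⟩ (t, θ n) ⟨ht, hθ n⟩ ?_
  rw [Prod.dist_eq, dist_self, dist_comm]
  exact max_lt hδ hn

theorem TendstoUniformlyOn.tendsto_integral_norm_sub {E : Type*} [NormedAddCommGroup E] {T : ℝ}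
    (hT : 0 ≤ T) {f : ℕ → ℝ → E} {f₀ : ℝ → E} (h : TendstoUniformlyOn f f₀ atTop (Icc 0 T)) :
    Tendsto (fun n => ∫ t in (0 : ℝ)..T, ‖f n t - f₀ t‖) atTop (𝓝 0) := by
  rw [Metric.tendsto_nhds]
  intro ε hε
  have hT1 : 0 < T + 1 := by linarith
  filter_upwards [Metric.tendstoUniformlyOn_iff.1 h (ε / (T + 1)) (by positivity)] with n hn
  rw [dist_zero_right]
  refine (intervalIntegral.norm_integral_le_of_norm_le_const (C := ε / (T + 1))
    fun t ht => ?_).trans_lt ?_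
  · rw [uIoc_of_le hT] at ht
    rw [norm_norm, ← dist_eq_norm, dist_comm]
    exact (hn t (Ioc_subset_Icc_self ht)).le
  · rw [sub_zero, abs_of_nonneg hT, div_mul_eq_mul_div, div_lt_iff₀ hT1]
    nlinarith

theorem sq_integral_le_mul_integral_sq {E : Type*} [NormedAddCommGroup E] {T : ℝ} (hT : 0 < T)
    {u : ℝ → E} (hu : MemLp u 2 (volume.restrict (Icc 0 T))) :
    (∫ t in (0 : ℝ)..T, ‖u t‖) ^ 2 ≤ T * ∫ t in Icc 0 T, ‖u t‖ ^ 2 := by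
  have h1 : IntervalIntegrable (fun t => ‖u t‖) volume 0 T :=
    (hu.intervalIntegrable_of_Icc hT.le).norm
  have h2 : IntervalIntegrable (fun t => ‖u t‖ ^ 2) volume 0 T := by
    rw [intervalIntegrable_iff_integrableOn_Ioc_of_le hT.le,
      ← integrableOn_Icc_iff_integrableOn_Ioc]
    exact MemLp.integrable_norm_pow (p := 2) (by exact_mod_cast hu) two_ne_zero
  rw [integral_Icc_eq_intervalIntegral hT.le]
  -- the variance of `‖u‖` around its mean `m` is nonnegative
  set m := (∫ t in (0 : ℝ)..T, ‖u t‖) / T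
  have hm : ∫ t in (0 : ℝ)..T, ‖u t‖ = T * m := by simp only [m]; field_simp
  have h0 : 0 ≤ ∫ t in (0 : ℝ)..T, (‖u t‖ ^ 2 - 2 * m * ‖u t‖ + m ^ 2) :=
    intervalIntegral.integral_nonneg hT.le fun t _ => by nlinarith [sq_nonneg (‖u t‖ - m)]
  rw [intervalIntegral.integral_add (h2.sub (h1.const_mul _)) intervalIntegrable_const,
    intervalIntegral.integral_sub h2 (h1.const_mul _), intervalIntegral.integral_const_mul,
    intervalIntegral.integral_const, hm, smul_eq_mul] at h0
  rw [hm]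
  nlinarith

theorem tendsto_integral_norm_of_sq {E : Type*} [NormedAddCommGroup E] {T : ℝ} (hT : 0 < T)
    {u : ℕ → ℝ → E} (hu : ∀ n, MemLp (u n) 2 (volume.restrict (Icc 0 T)))
    (h : Tendsto (fun n => ∫ t in Icc 0 T, ‖u n t‖ ^ 2) atTop (𝓝 0)) :
    Tendsto (fun n => ∫ t in (0 : ℝ)..T, ‖u n t‖) atTop (𝓝 0) := by
  have h1 : Tendsto (fun n => Real.sqrt (T * ∫ t in Icc 0 T, ‖u n t‖ ^ 2)) atTop (𝓝 0) := by
    simpa using (h.const_mul T).sqrt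
  exact squeeze_zero
    (fun n => intervalIntegral.integral_nonneg hT.le fun _ _ => norm_nonneg _)
    (fun n => Real.le_sqrt_of_sq_le (sq_integral_le_mul_integral_sq hT (hu n))) h1

theorem eqOn_zero_of_integral_norm_eq_zero {E : Type*} [NormedAddCommGroup E] {T : ℝ} (hT : 0 < T)
    {f : ℝ → E} (hf : ContinuousOn f (Icc 0 T)) (h : ∫ t in (0 : ℝ)..T, ‖f t‖ = 0) :
    EqOn f 0 (Icc 0 T) := by
  rw [← integral_Icc_eq_intervalIntegral hT.le,
    integral_eq_zero_iff_of_nonneg (fun _ => norm_nonneg _) (hf.memLp_restrict_Icc.integrable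
      one_le_two).norm] at h
  refine Measure.eqOn_Icc_of_ae_eq (μ := volume) hT.ne ?_ hf continuousOn_const
  filter_upwards [h] with t ht
  simpa using ht

theorem integral_norm_sq_le_of_eLpNorm_le {α E : Type*} [MeasurableSpace α] {ν : Measure α}
    [NormedAddCommGroup E] {f : α → E} (hf : MemLp f 2 ν) {δ : ℝ} (hδ : 0 ≤ δ)
    (h : eLpNorm f 2 ν ≤ ENNReal.ofReal δ) : ∫ t, ‖f t‖ ^ 2 ∂ν ≤ δ ^ 2 := by
  rw [hf.eLpNorm_eq_integral_rpow_norm two_ne_zero ENNReal.ofNat_ne_top,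
    ENNReal.ofReal_le_ofReal_iff hδ] at h
  simp only [ENNReal.toReal_ofNat, Real.rpow_two] at h
  have h0 : 0 ≤ ∫ t, ‖f t‖ ^ 2 ∂ν := integral_nonneg fun _ => by positivity
  rwa [← one_div, ← Real.sqrt_eq_rpow, Real.sqrt_le_left hδ] at h

/-! ### The trajectories of the model -/

namespace KalmanODE.LinearModel

variable {p d q : ℕ} {M : LinearModel p d q} {Θ : Set (EuclideanSpace ℝ (Fin p))}
  {θ : EuclideanSpace ℝ (Fin p)}

/-- The drift matrix `A_θ(t)` as an operator on Euclidean space. -/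
noncomputable def drift (M : LinearModel p d q) (θ : EuclideanSpace ℝ (Fin p)) (t : ℝ) :
    EuclideanSpace ℝ (Fin d) →L[ℝ] EuclideanSpace ℝ (Fin d) :=
  Matrix.toEuclideanCLM (n := Fin d) (𝕜 := ℝ) (M.A θ t)

/-- The observation matrix `C` as an operator between Euclidean spaces. -/
noncomputable def outputCLM (M : LinearModel p d q) :
    EuclideanSpace ℝ (Fin d) →L[ℝ] EuclideanSpace ℝ (Fin q) :=
  LinearMap.toContinuousLinearMap (Matrix.toLpLin 2 2 M.C)

theorem isSolution_iff {x₀ : EuclideanSpace ℝ (Fin d)} {u x : ℝ → EuclideanSpace ℝ (Fin d)} :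
    M.IsSolution θ x₀ u x ↔
      IsLinearSolution M.T (M.drift θ) (fun t => M.r θ t + u t) x₀ x := by
  have : ∀ s, M.field θ s (x s) + u s = M.drift θ s (x s) + (M.r θ s + u s) := fun s =>
    add_assoc _ _ _
  simp only [IsSolution, IsLinearSolution, this]

theorem continuousOn_uncurry_drift
    (hA : ContinuousOn (fun z : ℝ × EuclideanSpace ℝ (Fin p) => M.A z.2 z.1) (Icc 0 M.T ×ˢ Θ)) :
    ContinuousOn (fun z : ℝ × EuclideanSpace ℝ (Fin p) => M.drift z.2 z.1) (Icc 0 M.T ×ˢ Θ) := by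
  have : Continuous ((Matrix.toEuclideanCLM (n := Fin d) (𝕜 := ℝ)).toAlgEquiv.toLinearMap) :=
    LinearMap.continuous_of_finiteDimensional _
  exact this.comp_continuousOn hA

theorem continuousOn_slice {F : Type*} [TopologicalSpace F] {S : Set ℝ}
    {f : EuclideanSpace ℝ (Fin p) → ℝ → F}
    (hf : ContinuousOn (fun z : ℝ × EuclideanSpace ℝ (Fin p) => f z.2 z.1) (S ×ˢ Θ))
    (hθ : θ ∈ Θ) : ContinuousOn (f θ) S :=
  hf.comp (f := fun t => (t, θ)) (by fun_prop) fun _ ht => ⟨ht, hθ⟩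

theorem isLinearSolution_trajectory (hT : 0 ≤ M.T) (hA : ContinuousOn (M.drift θ) (Icc 0 M.T))
    (hr : ContinuousOn (M.r θ) (Icc 0 M.T)) (x₀ : EuclideanSpace ℝ (Fin d))
    {u : ℝ → EuclideanSpace ℝ (Fin d)} (hu : MemLp u 2 M.leb) :
    IsLinearSolution M.T (M.drift θ) (fun t => M.r θ t + u t) x₀ (M.trajectory θ x₀ u) := by
  have h : ∃ x, M.IsSolution θ x₀ u x := by
    obtain ⟨x, hx⟩ := exists_isLinearSolution hT hA
      ((hr.intervalIntegrable_of_mem_Icc ⟨hT, le_rfl⟩).add (hu.intervalIntegrable_of_Icc hT)) x₀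
    exact ⟨x, isSolution_iff.2 hx⟩
  rw [trajectory, dif_pos h]
  exact isSolution_iff.1 h.choose_spec

theorem trajectory_congr {x₀ : EuclideanSpace ℝ (Fin d)} {u v : ℝ → EuclideanSpace ℝ (Fin d)}
    (h : u =ᵐ[M.leb] v) : M.trajectory θ x₀ u = M.trajectory θ x₀ v := by
  have : M.IsSolution θ x₀ u = M.IsSolution θ x₀ v := by
    funext x
    simp only [isSolution_iff, eq_iff_iff]
    exact ⟨fun hx => hx.congr_forcing (h.mono fun t ht => by simp only [ht]),
      fun hx => hx.congr_forcing (h.mono fun t ht => by simp only [ht])⟩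
  unfold trajectory
  rw [this]

/-! ### The resolvent and the Gramian -/

theorem exists_isResolvent (hT : 0 ≤ M.T) (hA : ContinuousOn (M.drift θ) (Icc 0 M.T)) :
    ∃ Φ, M.IsResolvent θ 0 Φ := by
  choose y hy using fun j : Fin d => exists_isLinearSolution (g := fun _ => 0) hT hA
    intervalIntegrable_const (EuclideanSpace.single j (1 : ℝ))
  refine ⟨fun t => Matrix.of fun i j => y j t i, ?_, fun t ht i j => ?_⟩
  · ext i j
    simp [(hy j).apply_zero hT, Matrix.one_apply]
  · have hcont : ContinuousOn (fun s => M.drift θ s (y j s)) (Icc 0 M.T) :=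
      hA.clm_apply (hy j).1
    have hder : HasDerivWithinAt (y j) (M.drift θ t (y j t)) (Icc 0 M.T) t := by
      have : Fact (t ∈ Icc 0 M.T) := ⟨ht⟩
      refine HasDerivWithinAt.congr ((intervalIntegral.integral_hasDerivWithinAt_right
        (hcont.intervalIntegrable_of_mem_Icc ht)
        (hcont.stronglyMeasurableAtFilter_nhdsWithin measurableSet_Icc t)
        (hcont t ht)).const_add (EuclideanSpace.single j (1 : ℝ))) (fun s hs => ?_) ?_
      · simpa using (hy j).2 s hs
      · simpa using (hy j).2 t ht
    exact (EuclideanSpace.proj (𝕜 := ℝ) i).hasFDerivAt.comp_hasDerivWithinAt t hder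

theorem isResolvent_resolvent (hT : 0 ≤ M.T) (hA : ContinuousOn (M.drift θ) (Icc 0 M.T)) :
    M.IsResolvent θ 0 (fun t => M.resolvent θ t 0) := by
  have h := exists_isResolvent hT hA
  have : (fun t => M.resolvent θ t 0) = h.choose := by
    funext t
    rw [resolvent, dif_pos h]
  rw [this]
  exact h.choose_spec

theorem IsResolvent.isLinearSolution_mulVec
    (hA : ContinuousOn (M.drift θ) (Icc 0 M.T)) {Φ : ℝ → Matrix (Fin d) (Fin d) ℝ}
    (hΦ : M.IsResolvent θ 0 Φ) (v : EuclideanSpace ℝ (Fin d)) :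
    IsLinearSolution M.T (M.drift θ) (fun _ => 0) v
      (fun t => WithLp.toLp 2 ((Φ t).mulVec v.ofLp)) := by
  set y : ℝ → EuclideanSpace ℝ (Fin d) := fun t => WithLp.toLp 2 ((Φ t).mulVec v.ofLp)
  have hder : ∀ t ∈ Icc 0 M.T, HasDerivWithinAt y (M.drift θ t (y t)) (Icc 0 M.T) t := by
    intro t ht
    have h : HasDerivWithinAt (fun τ => (Φ τ).mulVec v.ofLp)
        ((M.A θ t * Φ t).mulVec v.ofLp) (Icc 0 M.T) t := by
      refine hasDerivWithinAt_pi.2 fun i => ?_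
      simp only [Matrix.mulVec, dotProduct]
      exact HasDerivWithinAt.fun_sum fun j _ => (hΦ.2 t ht i j).mul_const _
    have h2 := (EuclideanSpace.equiv (Fin d) ℝ).symm.toContinuousLinearMap.hasFDerivAt
      |>.comp_hasDerivWithinAt t h
    rw [← Matrix.mulVec_mulVec] at h2
    exact h2
  have hcont : ContinuousOn y (Icc 0 M.T) := fun t ht => (hder t ht).continuousWithinAt
  refine ⟨hcont, fun t ht => ?_⟩
  have hsub : Icc 0 t ⊆ Icc 0 M.T := Icc_subset_Icc_right ht.2
  have hint := intervalIntegral.integral_eq_sub_of_hasDerivAt_of_le ht.1 (hcont.mono hsub)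
    (fun s hs => (hder s (hsub (Ioo_subset_Icc_self hs))).hasDerivAt
      (Icc_mem_nhds hs.1 (hs.2.trans_le ht.2)))
    ((hA.clm_apply hcont).intervalIntegrable_of_mem_Icc ht)
  have h0 : y 0 = v := by simp [y, hΦ.1]
  simp only [add_zero]
  rw [hint, h0]
  abel

/-- The Gramian annihilates every initial state whose homogeneous trajectory is unobserved. -/
theorem gramian_mulVec_eq_zero (hT : 0 ≤ M.T) (hA : ContinuousOn (M.drift θ) (Icc 0 M.T))
    {v : Fin d → ℝ}
    (hv : ∀ t ∈ Icc 0 M.T, M.C.mulVec ((M.resolvent θ t 0).mulVec v) = 0) :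
    (M.gramian θ).mulVec v = 0 := by
  have hΦ := isResolvent_resolvent hT hA
  have hc : ∀ i j, ContinuousOn (fun t => M.resolvent θ t 0 i j) (Icc 0 M.T) :=
    fun i j t ht => (hΦ.2 t ht i j).continuousWithinAt
  have hΦc : ContinuousOn (fun t => M.resolvent θ t 0) (Icc 0 M.T) :=
    continuousOn_pi.2 fun i => continuousOn_pi.2 fun j => hc i j
  have hG : ContinuousOn (fun t => (M.resolvent θ t 0).transpose * M.C.transpose * M.C *
      M.resolvent θ t 0) (Icc 0 M.T) := by
    rw [continuousOn_iff_continuous_domRestrict] at hΦc ⊢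
    exact ((hΦc.matrix_transpose.matrix_mul continuous_const).matrix_mul
      continuous_const).matrix_mul hΦc
  have hi : ∀ i j, IntervalIntegrable (fun t => ((M.resolvent θ t 0).transpose * M.C.transpose *
      M.C * M.resolvent θ t 0) i j) volume 0 M.T := fun i j =>
    (continuousOn_pi.1 (continuousOn_pi.1 hG i) j).intervalIntegrable_of_mem_Icc ⟨hT, le_rfl⟩
  ext i
  simp only [gramian, Matrix.mulVec, dotProduct, Matrix.of_apply, Pi.zero_apply]
  simp_rw [← intervalIntegral.integral_mul_const]
  rw [← intervalIntegral.integral_finsetSum fun j _ => (hi i j).mul_const _]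
  refine (intervalIntegral.integral_congr (g := fun _ => 0) fun t ht => ?_).trans (by simp)
  rw [uIcc_of_le hT] at ht
  change ((M.resolvent θ t 0).transpose * M.C.transpose * M.C * M.resolvent θ t 0).mulVec v i = 0
  rw [← Matrix.mulVec_mulVec, ← Matrix.mulVec_mulVec, hv t ht, Matrix.mulVec_zero, Pi.zero_apply]

/-! ### Limits of almost fitting trajectories -/

/-- If the controls vanish and the outputs approach `Y` in `L²`, then after rescaling by `c n → c₀`
any limit `v` of the rescaled initial values starts a trajectory of the limiting model, with forcing
`c₀ r`, whose output is `c₀ Y`. The choice `c = 1` identifies the limit, while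
`c n = ‖x n‖⁻¹`, `c₀ = 0` controls unbounded initial values. -/
theorem output_eqOn_of_tendsto (hT : 0 < M.T) (hΘ : IsCompact Θ)
    (hA : ContinuousOn (fun z : ℝ × EuclideanSpace ℝ (Fin p) => M.A z.2 z.1) (Icc 0 M.T ×ˢ Θ))
    (hr : ContinuousOn (fun z : ℝ × EuclideanSpace ℝ (Fin p) => M.r z.2 z.1) (Icc 0 M.T ×ˢ Θ))
    {Y : ℝ → EuclideanSpace ℝ (Fin q)} (hY : ContinuousOn Y (Icc 0 M.T))
    {θ : ℕ → EuclideanSpace ℝ (Fin p)} {θ₀ : EuclideanSpace ℝ (Fin p)} (hθ : ∀ n, θ n ∈ Θ)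
    (hθ₀ : θ₀ ∈ Θ) (hθ_lim : Tendsto θ atTop (𝓝 θ₀))
    {x : ℕ → EuclideanSpace ℝ (Fin d)} {u : ℕ → ℝ → EuclideanSpace ℝ (Fin d)}
    (hu : ∀ n, MemLp (u n) 2 M.leb)
    (hu_lim : Tendsto (fun n => ∫ t, ‖u n t‖ ^ 2 ∂M.leb) atTop (𝓝 0))
    (hY_lim : Tendsto
      (fun n => ∫ t, ‖Y t - M.output (M.trajectory (θ n) (x n) (u n) t)‖ ^ 2 ∂M.leb) atTop (𝓝 0))
    {c : ℕ → ℝ} {c₀ : ℝ} (hc : Tendsto c atTop (𝓝 c₀)) {v : EuclideanSpace ℝ (Fin d)}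
    (hv : Tendsto (fun n => c n • x n) atTop (𝓝 v)) {y : ℝ → EuclideanSpace ℝ (Fin d)}
    (hy : IsLinearSolution M.T (M.drift θ₀) (fun t => c₀ • M.r θ₀ t) v y) :
    EqOn (fun t => c₀ • Y t) (fun t => M.output (y t)) (Icc 0 M.T) := by
  have hTT : M.T ∈ Icc 0 M.T := ⟨hT.le, le_rfl⟩
  have hA' := continuousOn_uncurry_drift hA
  have hAc : ∀ θ ∈ Θ, ContinuousOn (M.drift θ) (Icc 0 M.T) := fun θ h => continuousOn_slice hA' h
  have hrc : ∀ θ ∈ Θ, ContinuousOn (M.r θ) (Icc 0 M.T) := fun θ h => continuousOn_slice hr h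
  set z : ℕ → ℝ → EuclideanSpace ℝ (Fin d) := fun n => M.trajectory (θ n) (x n) (u n)
  have hz : ∀ n, IsLinearSolution M.T (M.drift (θ n)) (fun t => M.r (θ n) t + u n t) (x n) (z n) :=
    fun n => isLinearSolution_trajectory hT.le (hAc _ (hθ n)) (hrc _ (hθ n)) (x n) (hu n)
  have hri : ∀ θ ∈ Θ, IntervalIntegrable (M.r θ) volume 0 M.T := fun θ h =>
    (hrc θ h).intervalIntegrable_of_mem_Icc hTT
  have hui : ∀ n, IntervalIntegrable (u n) volume 0 M.T := fun n =>
    (hu n).intervalIntegrable_of_Icc hT.le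
  -- the rescaled forcing converges in mean
  have hforce : Tendsto (fun n => ∫ t in (0 : ℝ)..M.T,
      ‖c n • (M.r (θ n) t + u n t) - c₀ • M.r θ₀ t‖) atTop (𝓝 0) := by
    have h1 := (tendstoUniformlyOn_slice isCompact_Icc hΘ hr hθ hθ₀
      hθ_lim).tendsto_integral_norm_sub hT.le
    have h2 := tendsto_integral_norm_of_sq hT hu hu_lim
    have h3 : Tendsto (fun n => |c n - c₀|) atTop (𝓝 0) := by
      simpa using (hc.sub_const c₀).abs
    have hlim := ((hc.abs.mul h1).add (h3.mul_const (∫ t in (0 : ℝ)..M.T, ‖M.r θ₀ t‖))).add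
      (hc.abs.mul h2)
    simp only [mul_zero, zero_mul, add_zero] at hlim
    refine squeeze_zero (fun n => intervalIntegral.integral_nonneg hT.le fun _ _ => norm_nonneg _)
      (fun n => ?_) hlim
    have i1 := (((hri _ (hθ n)).sub (hri _ hθ₀)).norm).const_mul |c n|
    have i2 := ((hri _ hθ₀).norm).const_mul |c n - c₀|
    have i3 := ((hui n).norm).const_mul |c n|
    rw [← intervalIntegral.integral_const_mul, ← intervalIntegral.integral_const_mul,
      ← intervalIntegral.integral_const_mul, ← intervalIntegral.integral_add i1 i2,
      ← intervalIntegral.integral_add (i1.add i2) i3]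
    refine intervalIntegral.integral_mono_on hT.le
      ((((hri _ (hθ n)).add (hui n)).smul (c n)).sub ((hri _ hθ₀).smul c₀)).norm
      ((i1.add i2).add i3) fun t _ => ?_
    have e : c n • (M.r (θ n) t + u n t) - c₀ • M.r θ₀ t =
        c n • (M.r (θ n) t - M.r θ₀ t) + (c n - c₀) • M.r θ₀ t + c n • u n t := by module
    rw [e]
    refine norm_add₃_le.trans_eq ?_
    simp only [norm_smul, Real.norm_eq_abs]
  have hunif : TendstoUniformlyOn (fun n t => c n • z n t) y atTop (Icc 0 M.T) :=
    hy.tendstoUniformlyOn hT.le (hAc _ hθ₀) (fun n => hAc _ (hθ n)) ((hri _ hθ₀).smul c₀)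
      (fun n => ((hri _ (hθ n)).add (hui n)).smul (c n)) (fun n => (hz n).smul (c n))
      (tendstoUniformlyOn_slice isCompact_Icc hΘ hA' hθ hθ₀ hθ_lim) hforce hv
  have hout : Tendsto (fun n => ∫ t in (0 : ℝ)..M.T,
      ‖M.outputCLM (c n • z n t) - M.outputCLM (y t)‖) atTop (𝓝 0) :=
    TendstoUniformlyOn.tendsto_integral_norm_sub hT.le
      (M.outputCLM.uniformContinuous.comp_tendstoUniformlyOn hunif)
  have hCz : ∀ n, ContinuousOn (fun t => M.outputCLM (z n t)) (Icc 0 M.T) := fun n =>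
    M.outputCLM.continuous.comp_continuousOn (hz n).1
  have hCy : ContinuousOn (fun t => M.outputCLM (y t)) (Icc 0 M.T) :=
    M.outputCLM.continuous.comp_continuousOn hy.1
  have hfit : Tendsto (fun n => ∫ t in (0 : ℝ)..M.T, ‖Y t - M.outputCLM (z n t)‖) atTop (𝓝 0) :=
    tendsto_integral_norm_of_sq hT (fun n => (hY.sub (hCz n)).memLp_restrict_Icc) hY_lim
  have hdiff : ContinuousOn (fun t => c₀ • Y t - M.outputCLM (y t)) (Icc 0 M.T) :=
    (hY.const_smul c₀).sub hCy
  have hle : ∫ t in (0 : ℝ)..M.T, ‖c₀ • Y t - M.outputCLM (y t)‖ ≤ 0 := by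
    have h3 : Tendsto (fun n => |c₀ - c n|) atTop (𝓝 0) := by
      simpa using (hc.const_sub c₀).abs
    have hlim := ((h3.mul_const (∫ t in (0 : ℝ)..M.T, ‖Y t‖)).add (hc.abs.mul hfit)).add hout
    simp only [mul_zero, zero_mul, add_zero] at hlim
    refine ge_of_tendsto' hlim fun n => ?_
    have i1 := (hY.norm.intervalIntegrable_of_mem_Icc hTT).const_mul |c₀ - c n|
    have i2 : IntervalIntegrable (fun t => |c n| * ‖Y t - M.outputCLM (z n t)‖) volume 0 M.T :=
      ((hY.sub (hCz n)).norm.intervalIntegrable_of_mem_Icc hTT).const_mul |c n|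
    have i3 : IntervalIntegrable (fun t => ‖M.outputCLM (c n • z n t) - M.outputCLM (y t)‖)
        volume 0 M.T := by
      simp only [map_smul]
      exact (((hCz n).const_smul (c n)).sub hCy).norm.intervalIntegrable_of_mem_Icc hTT
    rw [← intervalIntegral.integral_const_mul, ← intervalIntegral.integral_const_mul,
      ← intervalIntegral.integral_add i1 i2, ← intervalIntegral.integral_add (i1.add i2) i3]
    refine intervalIntegral.integral_mono_on hT.le
      (hdiff.norm.intervalIntegrable_of_mem_Icc hTT) ((i1.add i2).add i3) fun t _ => ?_
    have e : c₀ • Y t - M.outputCLM (y t) = (c₀ - c n) • Y t + c n • (Y t - M.outputCLM (z n t)) +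
        (M.outputCLM (c n • z n t) - M.outputCLM (y t)) := by
      rw [map_smul]; module
    rw [e]
    refine norm_add₃_le.trans_eq ?_
    simp only [norm_smul, Real.norm_eq_abs]
  have h0 := eqOn_zero_of_integral_norm_eq_zero hT hdiff
    (hle.antisymm (intervalIntegral.integral_nonneg hT.le fun _ _ => norm_nonneg _))
  intro t ht
  exact sub_eq_zero.1 (h0 ht)

/-- Under observability, initial values of almost fitting trajectories stay bounded along a
subsequence: otherwise the normalized initial values would accumulate at a unit vector whose
homogeneous trajectory is unobserved, contradicting the nonsingularity of the Gramian. -/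
theorem exists_frequently_norm_le (hT : 0 < M.T) (hΘ : IsCompact Θ)
    (hobs : ∀ θ ∈ Θ, (M.gramian θ).det ≠ 0)
    (hA : ContinuousOn (fun z : ℝ × EuclideanSpace ℝ (Fin p) => M.A z.2 z.1) (Icc 0 M.T ×ˢ Θ))
    (hr : ContinuousOn (fun z : ℝ × EuclideanSpace ℝ (Fin p) => M.r z.2 z.1) (Icc 0 M.T ×ˢ Θ))
    {Y : ℝ → EuclideanSpace ℝ (Fin q)} (hY : ContinuousOn Y (Icc 0 M.T))
    {θ : ℕ → EuclideanSpace ℝ (Fin p)} {θ₀ : EuclideanSpace ℝ (Fin p)} (hθ : ∀ n, θ n ∈ Θ)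
    (hθ₀ : θ₀ ∈ Θ) (hθ_lim : Tendsto θ atTop (𝓝 θ₀))
    {x : ℕ → EuclideanSpace ℝ (Fin d)} {u : ℕ → ℝ → EuclideanSpace ℝ (Fin d)}
    (hu : ∀ n, MemLp (u n) 2 M.leb)
    (hu_lim : Tendsto (fun n => ∫ t, ‖u n t‖ ^ 2 ∂M.leb) atTop (𝓝 0))
    (hY_lim : Tendsto
      (fun n => ∫ t, ‖Y t - M.output (M.trajectory (θ n) (x n) (u n) t)‖ ^ 2 ∂M.leb) atTop (𝓝 0)) :
    ∃ R : ℝ, ∃ᶠ n in atTop, ‖x n‖ ≤ R := by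
  by_contra! h
  have hx : Tendsto (fun n => ‖x n‖) atTop atTop := tendsto_atTop.2 fun R =>
    (h R).mono fun n hn => hn.le
  have hsphere : ∀ n, ‖x n‖⁻¹ • x n ∈ Metric.closedBall (0 : EuclideanSpace ℝ (Fin d)) 1 := by
    intro n
    rw [mem_closedBall_zero_iff, norm_smul, norm_inv, norm_norm]
    exact inv_mul_le_one
  obtain ⟨v, -, φ, hφ, hv⟩ := tendsto_subseq_of_bounded Metric.isBounded_closedBall hsphere
  have hv1 : ‖v‖ = 1 := by
    refine tendsto_nhds_unique hv.norm (tendsto_const_nhds.congr' ?_)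
    filter_upwards [hφ.tendsto_atTop.eventually (hx.eventually_gt_atTop 0)] with n hn
    simp only [Function.comp_apply]
    rw [norm_smul, norm_inv, norm_norm, inv_mul_cancel₀ hn.ne']
  have hAc : ContinuousOn (M.drift θ₀) (Icc 0 M.T) :=
    continuousOn_slice (continuousOn_uncurry_drift hA) hθ₀
  have hsol := (isResolvent_resolvent hT.le hAc).isLinearSolution_mulVec hAc v
  have hφt := hφ.tendsto_atTop
  have h0 := output_eqOn_of_tendsto hT hΘ hA hr hY (fun n => hθ (φ n)) hθ₀ (hθ_lim.comp hφt)
    (fun n => hu (φ n)) (hu_lim.comp hφt) (hY_lim.comp hφt) (c₀ := 0)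
    (tendsto_inv_atTop_zero.comp (hx.comp hφt)) hv (by simpa only [zero_smul] using hsol)
  have hG : (M.gramian θ₀).mulVec v.ofLp = 0 := gramian_mulVec_eq_zero hT.le hAc fun t ht => by
    have := h0 ht
    simp only [zero_smul] at this
    exact congrArg WithLp.ofLp this.symm
  have hv0 : v.ofLp ≠ 0 := fun h => by
    have : v = 0 := by ext i; simpa using congrFun h i
    simp [this] at hv1
  exact hobs θ₀ hθ₀ (Matrix.exists_mulVec_eq_zero_iff.1 ⟨v.ofLp, hv0, hG⟩)

/-- Parameters of almost fitting trajectories accumulate at the true parameter. -/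
theorem exists_subseq_tendsto (hT : 0 < M.T) {θs : EuclideanSpace ℝ (Fin p)}
    {x₀s : EuclideanSpace ℝ (Fin d)} (hΘ : IsCompact Θ) (hθs : θs ∈ Θ)
    (hobs : ∀ θ ∈ Θ, (M.gramian θ).det ≠ 0) (hident : M.Identifiable Θ θs x₀s)
    (hA : ContinuousOn (fun z : ℝ × EuclideanSpace ℝ (Fin p) => M.A z.2 z.1) (Icc 0 M.T ×ˢ Θ))
    (hr : ContinuousOn (fun z : ℝ × EuclideanSpace ℝ (Fin p) => M.r z.2 z.1) (Icc 0 M.T ×ˢ Θ))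
    {θ : ℕ → EuclideanSpace ℝ (Fin p)} (hθ : ∀ n, θ n ∈ Θ)
    {x : ℕ → EuclideanSpace ℝ (Fin d)} {u : ℕ → ℝ → EuclideanSpace ℝ (Fin d)}
    (hu : ∀ n, MemLp (u n) 2 M.leb)
    (hu_lim : Tendsto (fun n => ∫ t, ‖u n t‖ ^ 2 ∂M.leb) atTop (𝓝 0))
    (hY_lim : Tendsto (fun n => ∫ t, ‖M.freeOutput θs x₀s t -
      M.output (M.trajectory (θ n) (x n) (u n) t)‖ ^ 2 ∂M.leb) atTop (𝓝 0)) :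
    ∃ φ : ℕ → ℕ, StrictMono φ ∧ Tendsto (θ ∘ φ) atTop (𝓝 θs) := by
  have hfree : ∀ θ ∈ Θ, ∀ x₀,
      IsLinearSolution M.T (M.drift θ) (M.r θ) x₀ (M.trajectory θ x₀ 0) := by
    intro θ h x₀
    simpa using isLinearSolution_trajectory hT.le
      (continuousOn_slice (continuousOn_uncurry_drift hA) h) (continuousOn_slice hr h) x₀
      (MemLp.zero (p := 2) (μ := M.leb))
  have hY : ContinuousOn (M.freeOutput θs x₀s) (Icc 0 M.T) :=
    M.outputCLM.continuous.comp_continuousOn (hfree θs hθs x₀s).1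
  obtain ⟨θ₀, hθ₀, φ, hφ, hφ_lim⟩ := hΘ.tendsto_subseq hθ
  have hφt := hφ.tendsto_atTop
  obtain ⟨R, hR⟩ := exists_frequently_norm_le hT hΘ hobs hA hr hY (fun n => hθ (φ n)) hθ₀ hφ_lim
    (x := x ∘ φ) (fun n => hu (φ n)) (hu_lim.comp hφt) (hY_lim.comp hφt)
  obtain ⟨x₀, -, ψ, hψ, hψ_lim⟩ := tendsto_subseq_of_frequently_bounded
    (Metric.isBounded_closedBall (x := (0 : EuclideanSpace ℝ (Fin d))) (r := R))
    (hR.mono fun n hn => mem_closedBall_zero_iff.2 hn)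
  have hψt := hψ.tendsto_atTop
  have h := output_eqOn_of_tendsto hT hΘ hA hr hY (fun n => hθ (φ (ψ n))) hθ₀ (hφ_lim.comp hψt)
    (fun n => hu (φ (ψ n))) (hu_lim.comp (hφt.comp hψt)) (hY_lim.comp (hφt.comp hψt))
    (c := fun _ => 1) tendsto_const_nhds (by simpa only [one_smul, Function.comp_def] using hψ_lim)
    (by simpa only [one_smul] using hfree θ₀ hθ₀ x₀)
  have heq : θ₀ = θs := (hident θ₀ hθ₀ x₀ fun t ht => by
    have := h ht
    simp only [one_smul] at this
    exact this.symm).1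
  exact ⟨φ, hφ, heq ▸ hφ_lim⟩

/-! ### The profiled cost -/

section ProfiledCost

variable {ζ : ℝ → EuclideanSpace ℝ (Fin q)} {lam : ℝ}

theorem cost_zero_nonneg (hlam : 0 ≤ lam) (x₀ : EuclideanSpace ℝ (Fin d))
    (u : ℝ → EuclideanSpace ℝ (Fin d)) : 0 ≤ M.cost 0 ζ x₀ u θ lam := by
  rw [cost, Matrix.zero_mulVec, dotProduct_zero, zero_add]
  exact add_nonneg (integral_nonneg fun _ => by positivity)
    (mul_nonneg hlam (integral_nonneg fun _ => by positivity))

theorem profiledCost_zero_le_free (hlam : 0 ≤ lam) (x₀ : EuclideanSpace ℝ (Fin d)) :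
    M.profiledCost 0 ζ θ lam ≤ ∫ t, ‖ζ t - M.freeOutput θ x₀ t‖ ^ 2 ∂M.leb := by
  have hbdd : ∀ x₀, BddBelow (range fun u : Lp (EuclideanSpace ℝ (Fin d)) 2 M.leb =>
      M.cost 0 ζ x₀ u θ lam) := fun x₀ => ⟨0, by
    rintro _ ⟨u, rfl⟩
    exact cost_zero_nonneg hlam x₀ u⟩
  have hbdd' : BddBelow (range fun x₀ => ⨅ u : Lp (EuclideanSpace ℝ (Fin d)) 2 M.leb,
      M.cost 0 ζ x₀ u θ lam) := ⟨0, by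
    rintro _ ⟨x₀, rfl⟩
    exact le_ciInf fun u => cost_zero_nonneg hlam x₀ u⟩
  refine (ciInf_le hbdd' x₀).trans ((ciInf_le (hbdd x₀) 0).trans_eq ?_)
  -- the representative of the class of `0` vanishes only almost everywhere
  have h0 := Lp.coeFn_zero (EuclideanSpace ℝ (Fin d)) 2 M.leb
  have hu : ∫ t, ‖(0 : Lp (EuclideanSpace ℝ (Fin d)) 2 M.leb) t‖ ^ 2 ∂M.leb = 0 := by
    refine (integral_congr_ae (h0.mono fun t ht => ?_)).trans (integral_zero ℝ ℝ)
    simp only [ht]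
    simp
  rw [cost, hu, trajectory_congr h0, Matrix.zero_mulVec, dotProduct_zero, zero_add, mul_zero,
    add_zero]
  rfl

theorem exists_cost_lt_of_profiledCost_lt {Q : Matrix (Fin d) (Fin d) ℝ} {b : ℝ}
    (h : M.profiledCost Q ζ θ lam < b) :
    ∃ (x₀ : EuclideanSpace ℝ (Fin d)) (u : Lp (EuclideanSpace ℝ (Fin d)) 2 M.leb),
      M.cost Q ζ x₀ u θ lam < b := by
  obtain ⟨x₀, hx₀⟩ := exists_lt_of_ciInf_lt h
  obtain ⟨u, hu⟩ := exists_lt_of_ciInf_lt hx₀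
  exact ⟨x₀, u, hu⟩

end ProfiledCost

/-! ### Stability of the minimizers and consistency -/

/-- The estimator is continuous in the data at the noiseless output: whenever `ζ` is
`L²`-close to the true output, every minimizer is close to the true parameter. -/
theorem exists_forall_isEstimate_dist_lt (hT : 0 < M.T) {lam : ℝ} (hlam : 0 < lam)
    {θs : EuclideanSpace ℝ (Fin p)} {x₀s : EuclideanSpace ℝ (Fin d)} (hΘ : IsCompact Θ)
    (hθs : θs ∈ Θ) (hobs : ∀ θ ∈ Θ, (M.gramian θ).det ≠ 0) (hident : M.Identifiable Θ θs x₀s)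
    (hA : ContinuousOn (fun z : ℝ × EuclideanSpace ℝ (Fin p) => M.A z.2 z.1) (Icc 0 M.T ×ˢ Θ))
    (hr : ContinuousOn (fun z : ℝ × EuclideanSpace ℝ (Fin p) => M.r z.2 z.1) (Icc 0 M.T ×ˢ Θ))
    {ε : ℝ} (hε : 0 < ε) :
    ∃ δ : ℝ, 0 < δ ∧ ∀ ζ : ℝ → EuclideanSpace ℝ (Fin q), MemLp ζ 2 M.leb →
      eLpNorm (fun t => ζ t - M.freeOutput θs x₀s t) 2 M.leb < ENNReal.ofReal δ →
      ∀ θ, M.IsEstimate 0 Θ ζ lam θ → dist θ θs < ε := by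
  by_contra! hcon
  choose ζ hζ hζδ θ hθ hθε using fun n : ℕ => hcon (1 / ((n : ℝ) + 1)) (by positivity)
  have hsol : ∀ θ ∈ Θ, ∀ x₀, ∀ u, MemLp u 2 M.leb →
      MemLp (fun t => M.output (M.trajectory θ x₀ u t)) 2 M.leb := fun θ h x₀ u hu =>
    ContinuousOn.memLp_restrict_Icc (M.outputCLM.continuous.comp_continuousOn
      (isLinearSolution_trajectory hT.le (continuousOn_slice (continuousOn_uncurry_drift hA) h)
        (continuousOn_slice hr h) x₀ hu).1)
  have hYs : MemLp (M.freeOutput θs x₀s) 2 M.leb := hsol θs hθs x₀s 0 MemLp.zero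
  set δ : ℕ → ℝ := fun n => 1 / ((n : ℝ) + 1)
  have hδ : ∀ n, 0 < δ n := fun n => by positivity
  have hδ_lim : Tendsto δ atTop (𝓝 0) := tendsto_one_div_add_atTop_nhds_zero_nat
  have hD : ∀ n, ∫ t, ‖ζ n t - M.freeOutput θs x₀s t‖ ^ 2 ∂M.leb ≤ δ n ^ 2 := fun n =>
    integral_norm_sq_le_of_eLpNorm_le ((hζ n).sub hYs) (hδ n).le (hζδ n).le
  -- the minimal cost is at most that of the true model without control
  have hlt : ∀ n, M.profiledCost 0 (ζ n) (θ n) lam < δ n ^ 2 + δ n := fun n =>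
    ((((hθ n).2 θs hθs).trans (profiledCost_zero_le_free hlam.le x₀s)).trans (hD n)).trans_lt
      (lt_add_of_pos_right _ (hδ n))
  choose x u hcost using fun n => exists_cost_lt_of_profiledCost_lt (hlt n)
  have hum : ∀ n, MemLp (u n) 2 M.leb := fun n => Lp.memLp (u n)
  have hbound : ∀ n,
      (∫ t, ‖ζ n t - M.output (M.trajectory (θ n) (x n) (u n) t)‖ ^ 2 ∂M.leb)
        + lam * ∫ t, ‖u n t‖ ^ 2 ∂M.leb ≤ δ n ^ 2 + δ n := fun n => by
    have := hcost n
    rw [cost, Matrix.zero_mulVec, dotProduct_zero, zero_add] at this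
    exact this.le
  have hfit0 : ∀ n, 0 ≤ ∫ t, ‖ζ n t - M.output (M.trajectory (θ n) (x n) (u n) t)‖ ^ 2 ∂M.leb :=
    fun n => integral_nonneg fun _ => by positivity
  have hctl0 : ∀ n, 0 ≤ ∫ t, ‖u n t‖ ^ 2 ∂M.leb := fun n => integral_nonneg fun _ => by positivity
  have hu_lim : Tendsto (fun n => ∫ t, ‖u n t‖ ^ 2 ∂M.leb) atTop (𝓝 0) := by
    have : Tendsto (fun n => (δ n ^ 2 + δ n) / lam) atTop (𝓝 0) := by
      simpa using ((hδ_lim.pow 2).add hδ_lim).div_const lam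
    refine squeeze_zero hctl0 (fun n => ?_) this
    rw [le_div_iff₀ hlam]
    linarith [hbound n, hfit0 n]
  have hY_lim : Tendsto (fun n => ∫ t, ‖M.freeOutput θs x₀s t -
      M.output (M.trajectory (θ n) (x n) (u n) t)‖ ^ 2 ∂M.leb) atTop (𝓝 0) := by
    have : Tendsto (fun n => 2 * δ n ^ 2 + 2 * (δ n ^ 2 + δ n)) atTop (𝓝 0) := by
      simpa using ((hδ_lim.pow 2).const_mul 2).add (((hδ_lim.pow 2).add hδ_lim).const_mul 2)
    refine squeeze_zero (fun n => integral_nonneg fun _ => by positivity) (fun n => ?_) this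
    have hsq : ∀ f : ℝ → EuclideanSpace ℝ (Fin q), MemLp f 2 M.leb →
        Integrable (fun t => ‖f t‖ ^ 2) M.leb := fun f hf =>
      MemLp.integrable_norm_pow (p := 2) (by exact_mod_cast hf) two_ne_zero
    have hX := hsol (θ n) (hθ n).1 (x n) (u n) (hum n)
    have i1 := (hsq _ ((hζ n).sub hYs)).const_mul 2
    have i2 := (hsq _ ((hζ n).sub hX)).const_mul 2
    have h1 := integral_mono (hsq _ (hYs.sub hX)) (i1.add i2) fun t => by
      have e : M.freeOutput θs x₀s t - M.output (M.trajectory (θ n) (x n) (u n) t) =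
          (ζ n t - M.output (M.trajectory (θ n) (x n) (u n) t)) -
            (ζ n t - M.freeOutput θs x₀s t) := by abel
      simp only [Pi.sub_apply, Pi.add_apply]
      rw [e]
      have := norm_sub_le (ζ n t - M.output (M.trajectory (θ n) (x n) (u n) t))
        (ζ n t - M.freeOutput θs x₀s t)
      have h0 := norm_nonneg ((ζ n t - M.output (M.trajectory (θ n) (x n) (u n) t)) -
        (ζ n t - M.freeOutput θs x₀s t))
      refine (pow_le_pow_left₀ h0 this 2).trans ((add_sq_le).trans_eq (by ring))
    rw [integral_add' i1 i2, integral_const_mul, integral_const_mul] at h1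
    have h2 := hD n
    have h3 := hbound n
    have h4 := mul_nonneg hlam.le (hctl0 n)
    simp only [Pi.sub_apply] at h1
    linarith
  obtain ⟨φ, -, hφ⟩ := exists_subseq_tendsto hT hΘ hθs hobs hident hA hr (fun n => (hθ n).1) hum
    hu_lim hY_lim
  obtain ⟨n, hn⟩ := (hφ.eventually (Metric.ball_mem_nhds θs hε)).exists
  exact (hθε (φ n)).not_gt hn

end KalmanODE.LinearModel

theorem mainTheorem2 {p d q : ℕ} (M : KalmanODE.LinearModel p d q) (hT : 0 < M.T)
    (lam : ℝ) (hlam : 0 < lam)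
    (Θ : Set (EuclideanSpace ℝ (Fin p)))
    (θs : EuclideanSpace ℝ (Fin p)) (x₀s : EuclideanSpace ℝ (Fin d))
    (Q : Matrix (Fin d) (Fin d) ℝ)
    -- C1
    (hΘ : IsCompact Θ) (hθs : θs ∈ interior Θ)
    -- C2a
    (hQ : Q = 0) (hobs : ∀ θ ∈ Θ, (M.gramian θ).det ≠ 0)
    -- C2b
    (hident : M.Identifiable Θ θs x₀s)
    -- C3
    (hA : ContinuousOn (fun z : ℝ × EuclideanSpace ℝ (Fin p) => M.A z.2 z.1)
      (Icc 0 M.T ×ˢ Θ))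
    (hr : ContinuousOn (fun z : ℝ × EuclideanSpace ℝ (Fin p) => M.r z.2 z.1)
      (Icc 0 M.T ×ˢ Θ))
    {Ω : Type*} [MeasurableSpace Ω] (μ : Measure Ω) [IsProbabilityMeasure μ]
    -- the sequence of (random) nonparametric estimators of the output, with values in L²
    (Yhat : ℕ → Ω → ℝ → EuclideanSpace ℝ (Fin q))
    (hYmem : ∀ n, ∀ᵐ ω ∂μ, MemLp (Yhat n ω) 2 M.leb)
    -- consistency in probability in L²
    (hYcons : ∀ ε : ℝ, 0 < ε → Tendsto
      (fun n => μ {ω | ENNReal.ofReal ε ≤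
        eLpNorm (fun t => Yhat n ω t - M.freeOutput θs x₀s t) 2 M.leb}) atTop (𝓝 0))
    -- the estimators minimize the profiled cost over Θ
    (θhat : ℕ → Ω → EuclideanSpace ℝ (Fin p))
    (hθhat : ∀ n, ∀ᵐ ω ∂μ, M.IsEstimate Q Θ (Yhat n ω) lam (θhat n ω)) :
    TendstoInMeasure μ θhat atTop (fun _ => θs) := by
  subst hQ
  rw [tendstoInMeasure_iff_dist]
  intro ε hε
  obtain ⟨δ, hδ, h⟩ := KalmanODE.LinearModel.exists_forall_isEstimate_dist_lt hT hlam hΘ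
    (interior_subset hθs) hobs hident hA hr hε
  refine tendsto_of_tendsto_of_tendsto_of_le_of_le tendsto_const_nhds (hYcons δ hδ)
    (fun _ => zero_le) fun n => measure_mono_ae ?_
  filter_upwards [hYmem n, hθhat n] with ω hω hest hfar
  by_contra hclose
  exact (h _ hω (not_le.1 hclose) _ hest).not_ge hfar
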